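/- Let $\mathcal A$ be a complex unital algebra and let $(\Omega(\mathcal A)=\bigoplus_{n\ge 0}\Omega^n(\mathcal A),\wedge,d)$ be a differential calculus over $\mathcal A$: the $\Omega^n(\mathcal A)$ are $\mathcal A$-bimodules (complex vector spaces on which the scalars act through $\mathcal A$ on either side), $\Omega^0(\mathcal A)=\mathcal A$, the product $\wedge$ is associative, graded and induced by $\mathcal A$-bimodule maps $\Omega^j\otimes_{\mathcal A}\Omega^k\to\Omega^{j+k}$ extending the bimodule actions, $d:\Omega^n\to\Omega^{n+1}$ is $\mathbb C$-linear with $d^2=0$ and $d(\omega\wedge\eta)=d\omega\wedge\eta+(-1)^{\deg\omega}\omega\wedge d\eta$, and $\Omega^n(\mathcal A)$ is the right $\mathcal A$-span of the elements $da_1\wedge\cdots\wedge da_n$. Put $\mathcal E=\Omega^1(\mathcal A)$, let $\mathcal Z(\cdot)$ denote the center of an algebra or of a bimodule, let $\mathrm{Hom}_{\mathcal A}$ denote right $\mathcal A$-linear maps, and let $\mathcal E^*=\mathrm{Hom}_{\mathcal A}(\mathcal E,\mathcal A)$ with $(a\phi)(e)=a\,\phi(e)$ and $(\phi a)(e)=\phi(ae)$.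 Assume that the calculus is tame: (i) $\mathcal E$ is finitely generated and projective as a right $\mathcal A$-module; (ii) $\mathcal E\otimes_{\mathcal A}\mathcal E=\mathrm{Ker}(\wedge)\oplus\mathcal F$ for a right $\mathcal A$-submodule $\mathcal F$; (iii) the map $\mathcal Z(\mathcal E)\otimes_{\mathcal Z(\mathcal A)}\mathcal A\to\mathcal E$, $e\otimes a\mapsto ea$, is bijective; (iv) if $P_{\rm sym}$ denotes the idempotent on $\mathcal E\otimes_{\mathcal A}\mathcal E$ with range $\mathrm{Ker}(\wedge)$ and kernel $\mathcal F$, then $\sigma:=2P_{\rm sym}-1$ satisfies $\sigma(\omega\otimes\eta)=\eta\otimes\omega$ for all $\omega,\eta\in\mathcal Z(\mathcal E)$. (Then $\sigma$ is also left $\mathcal A$-linear, and $\sigma_{23}:=\mathrm{id}\otimes\sigma$ on $\mathcal E\otimes_{\mathcal A}\mathcal E\otimes_{\mathcal A}\mathcal E$ is defined.) A pseudo-Riemannian metric is a $g\in\mathrm{Hom}_{\mathcal A}(\mathcal E\otimes_{\mathcal A}\mathcal E,\mathcal A)$ with $g\circ\sigma=g$ for which $V_g:\mathcal E\to\mathcal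 E^*$, $V_g(\omega)(\eta)=g(\omega\otimes\eta)$, is bijective; it is bilinear if it is also left $\mathcal A$-linear. A connection is a $\mathbb C$-linear map $\nabla:\mathcal E\to\mathcal E\otimes_{\mathcal A}\mathcal E$ with $\nabla(ea)=\nabla(e)a+e\otimes da$. It is a Levi-Civita connection for $g$ if it is torsionless, $\wedge\circ\nabla+d=0$, and compatible with $g$: $\Pi_g(\nabla)(e\otimes f)=d(g(e\otimes f))$ for all $e,f\in\mathcal E$, where $\Pi_g(\nabla):\mathcal E\otimes_{\mathcal A}\mathcal E\to\mathcal E$ is the well-defined $\mathbb C$-linear map with $$\Pi_g(\nabla)(\omega\otimes\eta a)=(g\otimes\mathrm{id})\sigma_{23}\big(\nabla(\omega)\otimes\eta+\nabla(\eta)\otimes\omega\big)a+g(\omega\otimes\eta)\,da\qquad(\omega,\eta\in\mathcal Z(\mathcal E),\ a\in\mathcal A).$$ Let $g_0$ be a bilinear pseudo-Riemannian metric. Let $\zeta:\mathcal E\otimes_{\mathcal A}\mathcal E^*\to\mathrm{Hom}_{\mathcal A}(\mathcal E,\mathcal E)$ be the isomorphism $\zeta(e\otimes\phi)(f)=e\,\phi(f)$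 and put $$\Omega_{g_0}=(\mathrm{id}_{\mathcal E}\otimes_{\mathcal A}V_{g_0}^{-1})\,\zeta^{-1}(\mathrm{id}_{\mathcal E})\in\mathcal E\otimes_{\mathcal A}\mathcal E .$$ **Theorem.** The element $\Omega_{g_0}$ is symmetric, that is, $\Omega_{g_0}\in\mathrm{Ker}(\wedge)=\mathrm{Ran}(P_{\rm sym})$. Moreover, if $\nabla_{g_0}$ is the Levi-Civita connection for $g_0$ and $k$ is an invertible element of $\mathcal A$, then the pseudo-Riemannian metric $k g_0$ has exactly one Levi-Civita connection $\nabla$, and for all $\omega\in\mathcal E$ $$\nabla(\omega)=\nabla_{g_0}(\omega)+k^{-1}P_{\rm sym}(dk\otimes_{\mathcal A}\omega)-\tfrac12\,k^{-1}\,\Omega_{g_0}\,g_0(dk\otimes_{\mathcal A}\omega).$$ -/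

import Mathlib

open MulOpposite
open scoped TensorProduct RightActions

noncomputable section

namespace NCGeometry

/-! ## The tensor product over a noncommutative algebra

Throughout, right `A`-modules are modules over `Aᵐᵒᵖ`; `m <• a` is the right action. -/

section BalancedTensor

variable (A : Type*) [Ring A]

/-- The subspace of `M ⊗[ℂ] N` spanned by the elements `ma ⊗ n - m ⊗ an`. -/
def balancedRel (M N : Type*) [AddCommGroup M] [Module ℂ M] [Module Aᵐᵒᵖ M]
    [AddCommGroup N] [Module ℂ N] [Module A N] : Submodule ℂ (M ⊗[ℂ] N) :=
  Submodule.span ℂ {t | ∃ (m : M) (a : A) (n : N), t = (m <• a) ⊗ₜ[ℂ] n - m ⊗ₜ[ℂ] (a • n)}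

/-- The tensor product `M ⊗_A N` of a right module `M` and a left module `N` over a complex,
not necessarily commutative, algebra `A`. -/
def BalancedTensor (M N : Type*) [AddCommGroup M] [Module ℂ M] [Module Aᵐᵒᵖ M]
    [AddCommGroup N] [Module ℂ N] [Module A N] : Type _ :=
  (M ⊗[ℂ] N) ⧸ balancedRel A M N

section Basic

variable {M N P : Type*} [AddCommGroup M] [Module ℂ M] [Module Aᵐᵒᵖ M]
  [AddCommGroup N] [Module ℂ N] [Module A N] [AddCommGroup P] [Module ℂ P]

instance : AddCommGroup (BalancedTensor A M N) :=
  inferInstanceAs (AddCommGroup ((M ⊗[ℂ] N) ⧸ balancedRel A M N))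

instance : Module ℂ (BalancedTensor A M N) :=
  inferInstanceAs (Module ℂ ((M ⊗[ℂ] N) ⧸ balancedRel A M N))

/-- The simple tensor `m ⊗_A n`. -/
def tmul : M →ₗ[ℂ] N →ₗ[ℂ] BalancedTensor A M N :=
  (TensorProduct.mk ℂ M N).compr₂ (balancedRel A M N).mkQ

theorem tmul_balanced (m : M) (a : A) (n : N) : tmul A (m <• a) n = tmul A m (a • n) := by
  refine (Submodule.Quotient.eq _).2 (Submodule.subset_span ⟨m, a, n, rfl⟩)

/-- The linear map on `M ⊗_A N` induced by a balanced bilinear map. -/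
def lift (f : M →ₗ[ℂ] N →ₗ[ℂ] P) (hf : ∀ (m : M) (a : A) (n : N), f (m <• a) n = f m (a • n)) :
    BalancedTensor A M N →ₗ[ℂ] P :=
  (balancedRel A M N).liftQ (TensorProduct.lift f) (by
    refine Submodule.span_le.2 ?_
    rintro _ ⟨m, a, n, rfl⟩
    simp [hf])

@[simp]
theorem lift_tmul (f : M →ₗ[ℂ] N →ₗ[ℂ] P)
    (hf : ∀ (m : M) (a : A) (n : N), f (m <• a) n = f m (a • n)) (m : M) (n : N) :
    lift A f hf (tmul A m n) = f m n :=
  TensorProduct.lift.tmul m n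

theorem tensor_induction {p : BalancedTensor A M N → Prop} (h0 : p 0)
    (h1 : ∀ m n, p (tmul A m n)) (h2 : ∀ x y, p x → p y → p (x + y)) (x) : p x := by
  obtain ⟨t, rfl⟩ := Submodule.Quotient.mk_surjective _ x
  induction t using TensorProduct.induction_on with
  | zero => exact h0
  | tmul m n => exact h1 m n
  | add s t hs ht => exact h2 _ _ hs ht

theorem hom_ext {f g : BalancedTensor A M N →ₗ[ℂ] P}
    (h : ∀ m n, f (tmul A m n) = g (tmul A m n)) : f = g := by
  ext x
  induction x using tensor_induction with
  | h0 => simp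
  | h1 m n => exact h m n
  | h2 x y hx hy => simp [hx, hy]

end Basic

variable [Algebra ℂ A]

section Left

variable {M N : Type*} [AddCommGroup M] [Module ℂ M] [Module Aᵐᵒᵖ M]
  [Module A M] [SMulCommClass A Aᵐᵒᵖ M] [IsScalarTower ℂ A M]
  [AddCommGroup N] [Module ℂ N] [Module A N]

/-- `m ⊗ n ↦ am ⊗ n`. -/
def leftMul (a : A) : Module.End ℂ (BalancedTensor A M N) :=
  lift A ((tmul A).comp (Algebra.lsmul ℂ ℂ M a)) (by
    intro m b n
    simp [smul_comm a (op b) m, tmul_balanced])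

theorem leftMul_tmul (a : A) (m : M) (n : N) : leftMul A a (tmul A m n) = tmul A (a • m) n :=
  lift_tmul A _ _ m n

/-- The left action `a(m ⊗ n) = am ⊗ n`, as a ring map into the endomorphisms. -/
def leftHom : A →+* Module.End ℂ (BalancedTensor A M N) where
  toFun a := leftMul A a
  map_one' := hom_ext A fun m n => by simp [leftMul_tmul]
  map_mul' a b := hom_ext A fun m n => by simp [mul_smul, leftMul_tmul]
  map_zero' := hom_ext A fun m n => by simp [leftMul_tmul]
  map_add' a b := hom_ext A fun m n => by simp [add_smul, leftMul_tmul]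

instance : Module A (BalancedTensor A M N) := Module.compHom _ (leftHom A (M := M) (N := N))

theorem smul_tmul (a : A) (m : M) (n : N) : a • tmul A m n = tmul A (a • m) n :=
  leftMul_tmul A a m n

instance : IsScalarTower ℂ A (BalancedTensor A M N) := by
  refine ⟨fun z a x => ?_⟩
  induction x using tensor_induction with
  | h0 => simp
  | h1 m n => simp [smul_tmul]
  | h2 x y hx hy => simp [hx, hy]

end Left

section Right

variable {M N : Type*} [AddCommGroup M] [Module ℂ M] [Module Aᵐᵒᵖ M]
  [AddCommGroup N] [Module ℂ N] [Module A N]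
  [Module Aᵐᵒᵖ N] [SMulCommClass A Aᵐᵒᵖ N] [IsScalarTower ℂ Aᵐᵒᵖ N]

/-- `m ⊗ n ↦ m ⊗ na`. -/
def rightMul (a : Aᵐᵒᵖ) : Module.End ℂ (BalancedTensor A M N) :=
  lift A ((tmul A).compl₂ (Algebra.lsmul ℂ ℂ N a)) (by
    intro m b n
    simp [← smul_comm b a n, tmul_balanced])

theorem rightMul_tmul (a : Aᵐᵒᵖ) (m : M) (n : N) :
    rightMul A a (tmul A m n) = tmul A m (a • n) :=
  lift_tmul A _ _ m n

/-- The right action `(m ⊗ n)a = m ⊗ na`, as a ring map into the endomorphisms. -/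
def rightHom : Aᵐᵒᵖ →+* Module.End ℂ (BalancedTensor A M N) where
  toFun a := rightMul A a
  map_one' := hom_ext A fun m n => by simp [rightMul_tmul]
  map_mul' a b := hom_ext A fun m n => by simp [mul_smul, rightMul_tmul]
  map_zero' := hom_ext A fun m n => by simp [rightMul_tmul]
  map_add' a b := hom_ext A fun m n => by simp [add_smul, rightMul_tmul]

instance : Module Aᵐᵒᵖ (BalancedTensor A M N) := Module.compHom _ (rightHom A (M := M) (N := N))

theorem op_smul_tmul (a : Aᵐᵒᵖ) (m : M) (n : N) : a • tmul A m n = tmul A m (a • n) :=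
  rightMul_tmul A a m n

instance : IsScalarTower ℂ Aᵐᵒᵖ (BalancedTensor A M N) := by
  refine ⟨fun z a x => ?_⟩
  induction x using tensor_induction with
  | h0 => simp
  | h1 m n => simp [op_smul_tmul]
  | h2 x y hx hy => simp [hx, hy]

instance [Module A M] [SMulCommClass A Aᵐᵒᵖ M] [IsScalarTower ℂ A M] :
    SMulCommClass A Aᵐᵒᵖ (BalancedTensor A M N) := by
  refine ⟨fun a b x => ?_⟩
  induction x using tensor_induction with
  | h0 => simp
  | h1 m n => simp [op_smul_tmul, smul_tmul]
  | h2 x y hx hy => simp [hx, hy]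

/-- The right `A`-linear map on `M ⊗_A N` induced by a balanced bilinear map that is right
`A`-linear in the second variable. -/
def liftRight {P : Type*} [AddCommGroup P] [Module ℂ P] [Module Aᵐᵒᵖ P]
    (f : M →ₗ[ℂ] N →ₗ[ℂ] P) (hf : ∀ (m : M) (a : A) (n : N), f (m <• a) n = f m (a • n))
    (hr : ∀ (m : M) (n : N) (a : Aᵐᵒᵖ), f m (a • n) = a • f m n) :
    BalancedTensor A M N →ₗ[Aᵐᵒᵖ] P where
  toFun := lift A f hf
  map_add' := map_add _
  map_smul' a x := by
    induction x using tensor_induction with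
    | h0 => simp
    | h1 m n => simp [op_smul_tmul, hr]
    | h2 x y hx hy => simp_all

@[simp]
theorem liftRight_tmul {P : Type*} [AddCommGroup P] [Module ℂ P] [Module Aᵐᵒᵖ P]
    (f : M →ₗ[ℂ] N →ₗ[ℂ] P) (hf : ∀ (m : M) (a : A) (n : N), f (m <• a) n = f m (a • n))
    (hr : ∀ (m : M) (n : N) (a : Aᵐᵒᵖ), f m (a • n) = a • f m n) (m : M) (n : N) :
    liftRight A f hf hr (tmul A m n) = f m n :=
  lift_tmul A f hf m n

end Right

/-- `id ⊗_A h` for a left `A`-linear map `h`. -/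
def idTensor (M : Type*) {N N' : Type*} [AddCommGroup M] [Module ℂ M] [Module Aᵐᵒᵖ M]
    [AddCommGroup N] [Module ℂ N] [Module A N] [IsScalarTower ℂ A N]
    [AddCommGroup N'] [Module ℂ N'] [Module A N'] [IsScalarTower ℂ A N']
    (h : N →ₗ[A] N') : BalancedTensor A M N →ₗ[ℂ] BalancedTensor A M N' :=
  lift A ((tmul A).compl₂ (h.restrictScalars ℂ)) (by intro m a n; simp [tmul_balanced])

@[simp]
theorem idTensor_tmul {M N N' : Type*} [AddCommGroup M] [Module ℂ M] [Module Aᵐᵒᵖ M]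
    [AddCommGroup N] [Module ℂ N] [Module A N] [IsScalarTower ℂ A N]
    [AddCommGroup N'] [Module ℂ N'] [Module A N'] [IsScalarTower ℂ A N']
    (h : N →ₗ[A] N') (m : M) (n : N) : idTensor A M h (tmul A m n) = tmul A m (h n) :=
  lift_tmul A _ _ m n

section Assoc

variable (M N P : Type*) [AddCommGroup M] [Module ℂ M] [Module Aᵐᵒᵖ M]
  [AddCommGroup N] [Module ℂ N] [Module A N]
  [Module Aᵐᵒᵖ N] [SMulCommClass A Aᵐᵒᵖ N] [IsScalarTower ℂ A N] [IsScalarTower ℂ Aᵐᵒᵖ N]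
  [AddCommGroup P] [Module ℂ P] [Module A P]

/-- `(m ⊗ n) ⊗ p ↦ m ⊗ (n ⊗ p)`. -/
def assocHom : BalancedTensor A (BalancedTensor A M N) P →ₗ[ℂ]
    BalancedTensor A M (BalancedTensor A N P) :=
  lift A
    (lift A (LinearMap.mk₂ ℂ (fun (m : M) (n : N) =>
        (tmul A (N := BalancedTensor A N P) m).comp (tmul A (N := P) n))
      (by intros; ext; simp) (by intros; ext; simp) (by intros; ext; simp)
      (by intros; ext; simp))
    (by intro m a n; ext p; simp [tmul_balanced, smul_tmul]))
    (by
      intro x a p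
      induction x using tensor_induction with
      | h0 => simp
      | h1 m n => simp [op_smul_tmul, tmul_balanced]
      | h2 x y hx hy => simp_all)

/-- `m ⊗ (n ⊗ p) ↦ (m ⊗ n) ⊗ p`. -/
def assocInv : BalancedTensor A M (BalancedTensor A N P) →ₗ[ℂ]
    BalancedTensor A (BalancedTensor A M N) P :=
  lift A
    (LinearMap.mk₂ ℂ (fun (m : M) (x : BalancedTensor A N P) =>
      lift A ((tmul A (M := BalancedTensor A M N) (N := P)).comp (tmul A (N := N) m))
        (by intro n a p; simp [← op_smul_tmul, tmul_balanced]) x)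
      (by
        intro m m' x
        induction x using tensor_induction with
        | h0 => simp
        | h1 n p => simp
        | h2 x y hx hy => rw [map_add, hx, hy, map_add, map_add]; abel)
      (by
        intro c m x
        induction x using tensor_induction with
        | h0 => simp
        | h1 n p => simp
        | h2 x y hx hy => simp only [map_add, hx, hy, smul_add])
      (by intros; simp) (by intros; simp))
    (by
      intro m a x
      induction x using tensor_induction with
      | h0 => simp
      | h1 n p => simp [smul_tmul, tmul_balanced]
      | h2 x y hx hy => simp only [map_add, hx, hy, smul_add])

/-- The associativity isomorphism `(M ⊗_A N) ⊗_A P ≃ M ⊗_A (N ⊗_A P)`. -/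
def assoc : BalancedTensor A (BalancedTensor A M N) P ≃ₗ[ℂ]
    BalancedTensor A M (BalancedTensor A N P) :=
  LinearEquiv.ofLinearMap (assocHom A M N P) (assocInv A M N P)
    (hom_ext A fun m x => by
      induction x using tensor_induction with
      | h0 => simp
      | h1 n p => simp [assocHom, assocInv]
      | h2 x y hx hy => simp_all)
    (hom_ext A fun x p => by
      induction x using tensor_induction with
      | h0 => simp
      | h1 m n => simp [assocHom, assocInv]
      | h2 x y hx hy => simp_all)

variable {M N P}

@[simp]
theorem assoc_tmul (m : M) (n : N) (p : P) :
    assoc A M N P (tmul A (tmul A m n) p) = tmul A m (tmul A n p) := by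
  simp [assoc, assocHom]

@[simp]
theorem assoc_symm_tmul (m : M) (n : N) (p : P) :
    (assoc A M N P).symm (tmul A m (tmul A n p)) = tmul A (tmul A m n) p := by
  rw [LinearEquiv.symm_apply_eq, assoc_tmul]

end Assoc

end BalancedTensor

/-! ## Duals of right modules and the map `ζ` -/

section Dual

variable (A : Type*) [Ring A] [Algebra ℂ A]

/-- The dual `M^* = Hom_A(M, A)` of a right `A`-module. -/
def RightDual (M : Type*) [AddCommGroup M] [Module Aᵐᵒᵖ M] : Type _ := M →ₗ[Aᵐᵒᵖ] A

variable {M N : Type*} [AddCommGroup M] [Module ℂ M] [Module Aᵐᵒᵖ M] [IsScalarTower ℂ Aᵐᵒᵖ M]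
  [AddCommGroup N] [Module Aᵐᵒᵖ N]

instance : AddCommGroup (RightDual A N) := inferInstanceAs (AddCommGroup (N →ₗ[Aᵐᵒᵖ] A))

instance : FunLike (RightDual A N) N A := inferInstanceAs (FunLike (N →ₗ[Aᵐᵒᵖ] A) N A)

instance : LinearMapClass (RightDual A N) Aᵐᵒᵖ N A :=
  inferInstanceAs (LinearMapClass (N →ₗ[Aᵐᵒᵖ] A) Aᵐᵒᵖ N A)

instance : Module ℂ (RightDual A N) := inferInstanceAs (Module ℂ (N →ₗ[Aᵐᵒᵖ] A))

/-- The left action `(a φ)(n) = a φ(n)`. -/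
instance : Module A (RightDual A N) := inferInstanceAs (Module A (N →ₗ[Aᵐᵒᵖ] A))

instance : IsScalarTower ℂ A (RightDual A N) :=
  inferInstanceAs (IsScalarTower ℂ A (N →ₗ[Aᵐᵒᵖ] A))

/-- The right action `(φ a)(n) = φ(a n)` on the dual of a bimodule. -/
instance [Module A N] [SMulCommClass A Aᵐᵒᵖ N] : Module Aᵐᵒᵖ (RightDual A N) where
  smul a φ := (LinearMap.comp (show N →ₗ[Aᵐᵒᵖ] A from φ)
    ({ toFun := fun n => a.unop • n
       map_add' := smul_add _
       map_smul' := fun b n => smul_comm a.unop b n } : N →ₗ[Aᵐᵒᵖ] N) : N →ₗ[Aᵐᵒᵖ] A)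
  one_smul φ := LinearMap.ext fun n => congrArg φ (one_smul A n)
  mul_smul a b φ := LinearMap.ext fun n => congrArg φ (mul_smul b.unop a.unop n)
  smul_zero _ := rfl
  smul_add _ _ _ := rfl
  add_smul a b φ := LinearMap.ext fun n =>
    (congrArg φ (add_smul a.unop b.unop n)).trans (map_add φ _ _)
  zero_smul φ := LinearMap.ext fun n =>
    (congrArg φ (zero_smul A n)).trans (map_zero φ)

/-- The map `ζ : M ⊗_A N^* → Hom_A(N, M)`, `ζ(m ⊗ φ)(n) = m φ(n)`. -/
def zeta : BalancedTensor A M (RightDual A N) →ₗ[ℂ] (N →ₗ[Aᵐᵒᵖ] M) :=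
  lift A
    (LinearMap.mk₂ ℂ (fun (m : M) (φ : RightDual A N) =>
      ({ toFun := fun n => m <• φ n
         map_add' := fun x y => by
          rw [map_add φ x y, op_add, add_smul]
         map_smul' := fun b x => by
          rw [show φ (b • x) = φ x * b.unop from map_smul φ b x, op_mul, mul_smul]
          rfl } : N →ₗ[Aᵐᵒᵖ] M))
      (fun m m' φ => LinearMap.ext fun n => smul_add _ m m')
      (fun c m φ => LinearMap.ext fun n => smul_comm _ c m)
      (fun m φ ψ => LinearMap.ext fun n => add_smul (op (φ n)) (op (ψ n)) m)
      (fun c m φ => LinearMap.ext fun n => smul_assoc c (op (φ n)) m))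
    (fun m a φ => LinearMap.ext fun n => (mul_smul (op (φ n)) (op a) m).symm)

@[simp]
theorem zeta_tmul (m : M) (φ : RightDual A N) (n : N) : zeta A (tmul A m φ) n = m <• φ n := by
  rw [zeta, lift_tmul]
  rfl

theorem zeta_bijective [Module.Finite Aᵐᵒᵖ N] [Module.Projective Aᵐᵒᵖ N] :
    Function.Bijective (zeta A (M := M) (N := N)) := by
  obtain ⟨n, f, g, -, -, hfg⟩ := Module.Finite.exists_comp_eq_id_of_projective Aᵐᵒᵖ N
  let b : Fin n → N := fun i => f (Pi.single i 1)
  let c : Fin n → RightDual A N := fun i =>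
    ({ toFun := fun x => (g x i).unop
       map_add' := fun x y => by simp
       map_smul' := fun r x => by simp } : N →ₗ[Aᵐᵒᵖ] A)
  have hb : ∀ x, ∑ i, b i <• (c i) x = x := fun x => by
    have h := LinearMap.congr_fun hfg x
    rw [LinearMap.comp_apply, LinearMap.id_apply, pi_eq_sum_univ' (g x), map_sum] at h
    refine Eq.trans (Finset.sum_congr rfl fun i _ => ?_) h
    rw [map_smul]
    rfl
  have hc : ∀ φ : RightDual A N, ∑ i, φ (b i) • c i = φ := fun φ => by
    refine LinearMap.ext fun x => ?_
    have h : φ (∑ i, b i <• (c i) x) = ∑ i, φ (b i) * c i x := by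
      refine (map_sum φ _ _).trans (Finset.sum_congr rfl fun i _ => ?_)
      exact map_smul φ _ _
    rw [hb] at h
    refine Eq.trans ?_ h.symm
    exact LinearMap.sum_apply _ _ _
  constructor
  · refine Function.LeftInverse.injective
      (g := fun ψ : N →ₗ[Aᵐᵒᵖ] M => ∑ i, tmul A (ψ (b i)) (c i)) fun X => ?_
    induction X using tensor_induction with
    | h0 => simp
    | h1 m φ =>
      simp only [zeta_tmul, tmul_balanced]
      rw [← map_sum, hc]
    | h2 x y hx hy =>
      simp only [map_add, LinearMap.add_apply, Finset.sum_add_distrib] at hx hy ⊢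
      rw [hx, hy]
  · intro ψ
    refine ⟨∑ i, tmul A (ψ (b i)) (c i), LinearMap.ext fun x => ?_⟩
    conv_rhs => rw [← hb x]
    simp

end Dual

/-! ## Differential calculi -/

section Calculus

/-- The data of a differential graded structure on a family `Ω n` of `A`-bimodules with `Ω 0 = A`:
an associative product `∧` of bimodules, and a differential `d` which is a graded derivation with
`d² = 0`. Degrees of products are recorded by equations `i + j = k`. -/
structure DifferentialAlgebra (A : Type*) [Ring A] [Algebra ℂ A] (Ω : ℕ → Type*)
    [∀ n, AddCommGroup (Ω n)] [∀ n, Module ℂ (Ω n)] [∀ n, Module A (Ω n)]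
    [∀ n, Module Aᵐᵒᵖ (Ω n)] where
  /-- the identification of `A` with `Ω 0`, as bimodules -/
  zeroEquiv : A ≃ₗ[ℂ] Ω 0
  zeroEquiv_mul_left : ∀ a b : A, zeroEquiv (a * b) = a • zeroEquiv b
  zeroEquiv_mul_right : ∀ a b : A, zeroEquiv (a * b) = zeroEquiv a <• b
  /-- the product `Ω i × Ω j → Ω (i + j)` -/
  wedge : ∀ {i j k : ℕ}, i + j = k → (Ω i →ₗ[ℂ] Ω j →ₗ[ℂ] Ω k)
  wedge_smul_left : ∀ {i j k : ℕ} (h : i + j = k) (a : A) (x : Ω i) (y : Ω j),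
    wedge h (a • x) y = a • wedge h x y
  wedge_smul_right : ∀ {i j k : ℕ} (h : i + j = k) (x : Ω i) (y : Ω j) (a : A),
    wedge h x (y <• a) = wedge h x y <• a
  wedge_balanced : ∀ {i j k : ℕ} (h : i + j = k) (x : Ω i) (a : A) (y : Ω j),
    wedge h (x <• a) y = wedge h x (a • y)
  zero_wedge : ∀ {j : ℕ} (a : A) (y : Ω j), wedge (Nat.zero_add j) (zeroEquiv a) y = a • y
  wedge_zero : ∀ {i : ℕ} (x : Ω i) (a : A), wedge (Nat.add_zero i) x (zeroEquiv a) = x <• a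
  wedge_assoc : ∀ {i j k ij jk n : ℕ} (h₁ : i + j = ij) (h₂ : ij + k = n) (h₃ : j + k = jk)
    (h₄ : i + jk = n) (x : Ω i) (y : Ω j) (z : Ω k),
    wedge h₂ (wedge h₁ x y) z = wedge h₄ x (wedge h₃ y z)
  /-- the differential -/
  d : ∀ n : ℕ, Ω n →ₗ[ℂ] Ω (n + 1)
  d_d : ∀ (n : ℕ) (x : Ω n), d (n + 1) (d n x) = 0
  d_wedge : ∀ {i j k : ℕ} (h : i + j = k) (x : Ω i) (y : Ω j),
    d k (wedge h x y) =
      wedge (show i + 1 + j = k + 1 by omega) (d i x) y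
        + (-1 : ℂ) ^ i • wedge (show i + (j + 1) = k + 1 by omega) x (d j y)

variable {A : Type*} [Ring A] [Algebra ℂ A] {Ω : ℕ → Type*}
  [∀ n, AddCommGroup (Ω n)] [∀ n, Module ℂ (Ω n)] [∀ n, Module A (Ω n)]
  [∀ n, Module Aᵐᵒᵖ (Ω n)]

/-- The differential `d : A → Ω 1`. -/
def DifferentialAlgebra.dA (C : DifferentialAlgebra A Ω) : A →ₗ[ℂ] Ω 1 :=
  (C.d 0).comp C.zeroEquiv.toLinearMap

/-- The set of the products `da₁ ∧ ⋯ ∧ daₙ` in `Ω n` (only `1` if `n = 0`). -/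
def DifferentialAlgebra.exactProducts (C : DifferentialAlgebra A Ω) : ∀ n : ℕ, Set (Ω n)
  | 0 => {C.zeroEquiv 1}
  | n + 1 => {w | ∃ a : A, ∃ y ∈ C.exactProducts n, w = C.wedge (Nat.add_comm 1 n) (C.dA a) y}

theorem DifferentialAlgebra.dA_mul (C : DifferentialAlgebra A Ω) (a b : A) :
    C.dA (a * b) = C.dA a <• b + a • C.dA b := by
  have h := C.d_wedge (Nat.add_zero 0) (C.zeroEquiv a) (C.zeroEquiv b)
  rw [C.wedge_zero, ← C.zeroEquiv_mul_right, pow_zero, one_smul] at h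
  refine h.trans (congrArg₂ (· + ·) (C.wedge_zero (i := 1) _ b) (C.zero_wedge (j := 1) a _))

/-- A differential calculus over `A`: every `Ω n` is moreover the right `A`-linear span of the
elements `da₁ ∧ ⋯ ∧ daₙ`. -/
structure DifferentialCalculus (A : Type*) [Ring A] [Algebra ℂ A] (Ω : ℕ → Type*)
    [∀ n, AddCommGroup (Ω n)] [∀ n, Module ℂ (Ω n)] [∀ n, Module A (Ω n)]
    [∀ n, Module Aᵐᵒᵖ (Ω n)] extends DifferentialAlgebra A Ω where
  generated : ∀ n, Submodule.span Aᵐᵒᵖ (toDifferentialAlgebra.exactProducts n) = ⊤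

end Calculus

/-! ## Centers of bimodules -/

section Center

variable (A : Type*) [Ring A] [Algebra ℂ A]
  (M : Type*) [AddCommGroup M] [Module A M] [Module Aᵐᵒᵖ M] [SMulCommClass A Aᵐᵒᵖ M]

/-- The center `Z(M) = {m | am = ma for all a}` of a bimodule, a module over the center `Z(A)`. -/
def bimoduleCenter : Submodule (Subalgebra.center ℂ A) M where
  carrier := {m | ∀ a : A, a • m = m <• a}
  zero_mem' := by simp
  add_mem' := by
    intro x y hx hy a
    simp [hx a, hy a]
  smul_mem' := by
    intro z x hx a
    have hz : a * z = z * a := (Subalgebra.mem_center_iff.1 z.2 a)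
    change a • (z : A) • x = (z • x) <• a
    rw [← mul_smul, hz, mul_smul, hx a]
    exact smul_comm (z : A) (op a) x

/-- The map `u : Z(M) ⊗_{Z(A)} A → M`, `u(m ⊗ a) = ma`. -/
def centerMul : bimoduleCenter A M ⊗[Subalgebra.center ℂ A] A →+ M :=
  TensorProduct.liftAddHom
    { toFun := fun m =>
        { toFun := fun a => (m : M) <• a
          map_zero' := by simp
          map_add' := fun a b => by simp [add_smul] }
      map_zero' := by ext; simp
      map_add' := fun m n => by ext; simp }
    (by
      intro z m a
      change ((z : A) • (m : M)) <• a = (m : M) <• ((z : A) * a)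
      rw [m.2 z, op_mul, mul_smul])

variable {A M}

@[simp]
theorem centerMul_tmul (m : bimoduleCenter A M) (a : A) :
    centerMul A M (m ⊗ₜ a) = (m : M) <• a := rfl

theorem center_induction (hM : Function.Surjective (centerMul A M)) {p : M → Prop} (h0 : p 0)
    (h1 : ∀ (m : bimoduleCenter A M) (a : A), p ((m : M) <• a))
    (h2 : ∀ x y, p x → p y → p (x + y)) (x : M) : p x := by
  obtain ⟨t, rfl⟩ := hM x
  induction t using TensorProduct.induction_on with
  | zero => simpa using h0
  | tmul m a => exact h1 m a
  | add s t hs ht => rw [map_add]; exact h2 _ _ hs ht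

theorem central_smul (hM : Function.Surjective (centerMul A M)) (z : A)
    (hz : ∀ a : A, a * z = z * a) (x : M) : z • x = x <• z := by
  induction x using center_induction hM with
  | h0 => simp
  | h1 m a => rw [smul_comm, m.2 z, ← mul_smul, ← mul_smul, ← op_mul, ← op_mul, hz a]
  | h2 x y hx hy => simp [hx, hy]

theorem tensor_center_induction [Module ℂ M] [IsScalarTower ℂ A M] [IsScalarTower ℂ Aᵐᵒᵖ M]
    (hM : Function.Surjective (centerMul A M)) {p : BalancedTensor A M M → Prop} (h0 : p 0)
    (h1 : ∀ (m n : bimoduleCenter A M) (a : A), p (tmul A (m : M) ((n : M) <• a)))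
    (h2 : ∀ x y, p x → p y → p (x + y)) (x : BalancedTensor A M M) : p x := by
  induction x using tensor_induction with
  | h0 => exact h0
  | h2 x y hx hy => exact h2 x y hx hy
  | h1 x y =>
    induction x using center_induction hM with
    | h0 => simpa using h0
    | h2 x x' hx hx' => simpa using h2 _ _ hx hx'
    | h1 m b =>
      induction y using center_induction hM with
      | h0 => simpa using h0
      | h2 y y' hy hy' => simpa using h2 _ _ hy hy'
      | h1 n a =>
        rw [tmul_balanced, smul_comm, n.2 b, ← mul_smul, ← op_mul]
        exact h1 m n (b * a)

end Center

/-! ## Tame differential calculi, metrics and connections -/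

section Tame

variable {A : Type*} [Ring A] [Algebra ℂ A] {Ω : ℕ → Type*}
  [∀ n, AddCommGroup (Ω n)] [∀ n, Module ℂ (Ω n)] [∀ n, Module A (Ω n)]
  [∀ n, Module Aᵐᵒᵖ (Ω n)] [∀ n, SMulCommClass A Aᵐᵒᵖ (Ω n)]
  [∀ n, IsScalarTower ℂ A (Ω n)] [∀ n, IsScalarTower ℂ Aᵐᵒᵖ (Ω n)]

/-- The product as a right `A`-linear map `∧ : Ω 1 ⊗_A Ω 1 → Ω 2`. -/
def DifferentialAlgebra.wedgeOne (C : DifferentialAlgebra A Ω) :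
    BalancedTensor A (Ω 1) (Ω 1) →ₗ[Aᵐᵒᵖ] Ω 2 :=
  liftRight A (C.wedge rfl) (C.wedge_balanced rfl)
    (fun x y a => C.wedge_smul_right rfl x y a.unop)

/-- A tame structure on a differential calculus. `F` is the complement of `Ker ∧` that splits the
short exact sequence `0 → Ker ∧ → Ω 1 ⊗_A Ω 1 → Ω 2 → 0` of right `A`-modules (the map `∧` is
onto as `Ω 2` is generated by the elements `da ∧ db`), and `Submodule.projection` is the idempotent
with range `Ker ∧` and kernel `F`. -/
structure Tame (C : DifferentialCalculus A Ω) where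
  finite : Module.Finite Aᵐᵒᵖ (Ω 1)
  projective : Module.Projective Aᵐᵒᵖ (Ω 1)
  F : Submodule Aᵐᵒᵖ (BalancedTensor A (Ω 1) (Ω 1))
  isCompl : IsCompl (LinearMap.ker C.wedgeOne) F
  centerMul_bijective : Function.Bijective (centerMul A (Ω 1))
  flip : ∀ ω η : bimoduleCenter A (Ω 1),
    2 • Submodule.projection (LinearMap.ker C.wedgeOne) F isCompl (tmul A (ω : Ω 1) (η : Ω 1))
      - tmul A (ω : Ω 1) (η : Ω 1) = tmul A (η : Ω 1) (ω : Ω 1)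

namespace Tame

variable {C : DifferentialCalculus A Ω} (T : Tame C)

/-- The idempotent `P_sym` on `Ω 1 ⊗_A Ω 1` with range `Ker ∧` and kernel `F`. -/
def Psym : BalancedTensor A (Ω 1) (Ω 1) →ₗ[Aᵐᵒᵖ] BalancedTensor A (Ω 1) (Ω 1) :=
  Submodule.projection (LinearMap.ker C.wedgeOne) T.F T.isCompl

/-- `σ = 2 P_sym - 1`. -/
def sigma : BalancedTensor A (Ω 1) (Ω 1) →ₗ[Aᵐᵒᵖ] BalancedTensor A (Ω 1) (Ω 1) where
  toFun X := 2 • T.Psym X - X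
  map_add' X Y := by simp only [map_add, smul_add]; abel
  map_smul' a X := by
    rw [map_smul, RingHom.id_apply, smul_sub, smul_comm]

theorem sigma_center (ω η : bimoduleCenter A (Ω 1)) :
    T.sigma (tmul A (ω : Ω 1) (η : Ω 1)) = tmul A (η : Ω 1) (ω : Ω 1) := T.flip ω η

theorem sigma_center_smul (ω η : bimoduleCenter A (Ω 1)) (a : Aᵐᵒᵖ) :
    T.sigma (tmul A (ω : Ω 1) (a • (η : Ω 1))) = tmul A (η : Ω 1) (a • (ω : Ω 1)) := by
  rw [← op_smul_tmul, map_smul, sigma_center, op_smul_tmul]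

theorem sigma_smul (b : A) (X : BalancedTensor A (Ω 1) (Ω 1)) :
    T.sigma (b • X) = b • T.sigma X := by
  induction X using tensor_center_induction T.centerMul_bijective.2 with
  | h0 => simp
  | h2 x y hx hy => simp only [smul_add, map_add, hx, hy]
  | h1 m n a =>
    have key : ∀ m n : bimoduleCenter A (Ω 1), b • tmul A (m : Ω 1) ((n : Ω 1) <• a)
        = tmul A (m : Ω 1) ((n : Ω 1) <• (b * a)) := fun m n => by
      rw [smul_tmul, m.2 b, tmul_balanced, smul_comm, n.2 b, ← mul_smul, ← op_mul]
    rw [key, sigma_center_smul, sigma_center_smul, key]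

/-- `σ` is left `A`-linear. -/
def sigmaLeft : BalancedTensor A (Ω 1) (Ω 1) →ₗ[A] BalancedTensor A (Ω 1) (Ω 1) where
  toFun := T.sigma
  map_add' := map_add _
  map_smul' := T.sigma_smul

/-- `σ₂₃ = id ⊗_A σ` on `Ω 1 ⊗_A Ω 1 ⊗_A Ω 1`. -/
def sigma23 : BalancedTensor A (BalancedTensor A (Ω 1) (Ω 1)) (Ω 1) →ₗ[ℂ]
    BalancedTensor A (BalancedTensor A (Ω 1) (Ω 1)) (Ω 1) :=
  (assoc A (Ω 1) (Ω 1) (Ω 1)).symm.toLinearMap ∘ₗ idTensor A (Ω 1) T.sigmaLeft ∘ₗ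
    (assoc A (Ω 1) (Ω 1) (Ω 1)).toLinearMap

end Tame

/-- The map `V_g : M → M^*`, `V_g(ω)(η) = g(ω ⊗ η)`, of right `A`-modules, for a bimodule `M` and
`g ∈ Hom_A(M ⊗_A M, A)`. -/
def metricMap {M : Type*} [AddCommGroup M] [Module ℂ M] [Module A M] [Module Aᵐᵒᵖ M]
    [SMulCommClass A Aᵐᵒᵖ M] [IsScalarTower ℂ Aᵐᵒᵖ M]
    (g : BalancedTensor A M M →ₗ[Aᵐᵒᵖ] A) : M →ₗ[Aᵐᵒᵖ] RightDual A M where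
  toFun ω := ({ toFun := fun η => g (tmul A ω η)
                map_add' := by simp
                map_smul' := fun a η => by
                  rw [← op_smul_tmul, map_smul, RingHom.id_apply] } : M →ₗ[Aᵐᵒᵖ] A)
  map_add' ω ω' := LinearMap.ext fun η => by
    change g (tmul A (ω + ω') η) = g (tmul A ω η) + g (tmul A ω' η)
    simp
  map_smul' a ω := LinearMap.ext fun η => by
    change g (tmul A (ω <• a.unop) η) = g (tmul A ω (a.unop • η))
    rw [tmul_balanced]

/-- A pseudo-Riemannian metric on the one-forms of a tame differential calculus. -/
structure PseudoRiemannianMetric {C : DifferentialCalculus A Ω} (T : Tame C) where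
  toHom : BalancedTensor A (Ω 1) (Ω 1) →ₗ[Aᵐᵒᵖ] A
  symmetric : ∀ X, toHom (T.sigma X) = toHom X
  nondegenerate : Function.Bijective (metricMap toHom)

namespace PseudoRiemannianMetric

variable {C : DifferentialCalculus A Ω} {T : Tame C} (g : PseudoRiemannianMetric T)

/-- `g` is bilinear if it is also left `A`-linear. -/
def IsBilinear : Prop := ∀ (a : A) (X : BalancedTensor A (Ω 1) (Ω 1)),
  g.toHom (a • X) = a * g.toHom X

/-- The conformal deformation `k g` of a metric by an invertible element `k`. -/
def conformal (k : Aˣ) : PseudoRiemannianMetric T where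
  toHom :=
    { toFun := fun X => k * g.toHom X
      map_add' := fun X Y => by rw [map_add, mul_add]
      map_smul' := fun a X => by
        rw [map_smul, RingHom.id_apply]
        exact (mul_assoc (k : A) (g.toHom X) a.unop).symm }
  symmetric X := congrArg (fun t => (k : A) * t) (g.symmetric X)
  nondegenerate := by
    constructor
    · intro ω ω' h
      refine g.nondegenerate.1 (LinearMap.ext fun η => k.isUnit.mul_left_cancel ?_)
      exact congrArg (fun φ : RightDual A (Ω 1) => φ η) h
    · intro φ
      obtain ⟨ω, hω⟩ := g.nondegenerate.2 ((↑k⁻¹ : A) • φ)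
      refine ⟨ω, LinearMap.ext fun η => ?_⟩
      have h : g.toHom (tmul A ω η) = (↑k⁻¹ : A) * φ η :=
        congrArg (fun φ : RightDual A (Ω 1) => φ η) hω
      change (k : A) * g.toHom (tmul A ω η) = φ η
      rw [h, Units.mul_inv_cancel_left]

/-- For a bilinear metric `g`, the map `V_g` is also an isomorphism of left `A`-modules. -/
def metricEquiv (hg : g.IsBilinear) : Ω 1 ≃ₗ[A] RightDual A (Ω 1) :=
  LinearEquiv.ofBijective
    { toFun := metricMap g.toHom
      map_add' := map_add _
      map_smul' := fun a ω => LinearMap.ext fun η => by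
        change g.toHom (tmul A (a • ω) η) = a * g.toHom (tmul A ω η)
        rw [← smul_tmul, hg] }
    g.nondegenerate

/-- The element `Ω_g = (id ⊗ V_g⁻¹) ζ⁻¹(id)` of `Ω 1 ⊗_A Ω 1`, for a bilinear metric `g`. -/
def metricElement (hg : g.IsBilinear) : BalancedTensor A (Ω 1) (Ω 1) :=
  haveI := T.finite
  haveI := T.projective
  idTensor A (Ω 1) (g.metricEquiv hg).symm.toLinearMap
    ((LinearEquiv.ofBijective (zeta A (M := Ω 1) (N := Ω 1)) (zeta_bijective A)).symm
      LinearMap.id)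

/-- `g ⊗_A id : (Ω 1 ⊗_A Ω 1) ⊗_A Ω 1 → A ⊗_A Ω 1 = Ω 1`. -/
def tensorId : BalancedTensor A (BalancedTensor A (Ω 1) (Ω 1)) (Ω 1) →ₗ[ℂ] Ω 1 :=
  lift A
    (LinearMap.mk₂ ℂ (fun X e => g.toHom X • e)
      (fun X Y e => by rw [map_add, add_smul])
      (fun c X e => by
        rw [show g.toHom (c • X) = c • g.toHom X from
          (g.toHom.restrictScalars ℂ).map_smul c X, smul_assoc])
      (fun X e f => smul_add _ e f)
      (fun c X e => smul_comm _ c e))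
    (fun X a e => by
      simp only [LinearMap.mk₂_apply, map_smul]
      exact mul_smul (g.toHom X) a e)

@[simp]
theorem tensorId_tmul (X : BalancedTensor A (Ω 1) (Ω 1)) (e : Ω 1) :
    g.tensorId (tmul A X e) = g.toHom X • e := lift_tmul A _ _ X e

/-- The map `(g ⊗_A id) σ₂₃`. -/
def contract : BalancedTensor A (BalancedTensor A (Ω 1) (Ω 1)) (Ω 1) →ₗ[ℂ] Ω 1 :=
  g.tensorId ∘ₗ T.sigma23

end PseudoRiemannianMetric

/-- A (right) connection on the bimodule of one-forms. -/
structure Connection (C : DifferentialCalculus A Ω) where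
  toHom : Ω 1 →ₗ[ℂ] BalancedTensor A (Ω 1) (Ω 1)
  leibniz : ∀ (e : Ω 1) (a : A), toHom (e <• a) = toHom e <• a + tmul A e (C.dA a)

/-- `∇` is torsionless if `∧ ∘ ∇ + d = 0`. -/
def Connection.IsTorsionless {C : DifferentialCalculus A Ω} (D : Connection C) : Prop :=
  ∀ e : Ω 1, C.wedgeOne (D.toHom e) + C.d 1 e = 0

namespace PseudoRiemannianMetric

variable {C : DifferentialCalculus A Ω} {T : Tame C} (g : PseudoRiemannianMetric T)

theorem contract_tmul (e f h : Ω 1) :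
    g.contract (tmul A (tmul A e f) h)
      = g.tensorId ((assoc A _ _ _).symm (tmul A e (T.sigma (tmul A f h)))) := by
  simp [contract, Tame.sigma23, Tame.sigmaLeft]

theorem contract_center (e f : Ω 1) (η : bimoduleCenter A (Ω 1)) :
    g.contract (tmul A (tmul A e f) (η : Ω 1)) = g.toHom (tmul A e (η : Ω 1)) • f := by
  rw [contract_tmul]
  induction f using center_induction T.centerMul_bijective.2 with
  | h0 => simp
  | h1 m a =>
    rw [tmul_balanced, η.2 a, T.sigma_center_smul, assoc_symm_tmul, tensorId_tmul]
  | h2 x y hx hy => simp only [map_add, LinearMap.add_apply, hx, hy, smul_add]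

theorem contract_smul (x : BalancedTensor A (BalancedTensor A (Ω 1) (Ω 1)) (Ω 1)) (a : A) :
    g.contract (x <• a) = g.contract x <• a := by
  induction x using tensor_induction with
  | h0 => simp
  | h2 x y hx hy => simp only [smul_add, map_add, hx, hy]
  | h1 X h =>
    induction X using tensor_induction with
    | h0 => simp
    | h2 x y hx hy => simp only [smul_add, map_add, LinearMap.add_apply, hx, hy]
    | h1 e f =>
      rw [op_smul_tmul, contract_tmul, contract_tmul, ← op_smul_tmul, map_smul]
      generalize T.sigma (tmul A f h) = Y
      induction Y using tensor_induction with
      | h0 => simp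
      | h2 x y hx hy => simp only [smul_add, map_add, hx, hy]
      | h1 u v =>
        rw [op_smul_tmul, assoc_symm_tmul, assoc_symm_tmul, tensorId_tmul, tensorId_tmul,
          smul_comm]

/-- `(e, η) ↦ (g ⊗ id) σ₂₃ (∇(e) ⊗ η + ∇(η) ⊗ e)`. -/
def pi0 (D : Connection C) (e η : Ω 1) : Ω 1 :=
  g.contract (tmul A (D.toHom e) η + tmul A (D.toHom η) e)

theorem toHom_center_comm (ω η : bimoduleCenter A (Ω 1)) :
    g.toHom (tmul A (ω : Ω 1) (η : Ω 1)) = g.toHom (tmul A (η : Ω 1) (ω : Ω 1)) := by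
  rw [← T.sigma_center, g.symmetric]

theorem pi0_smul (D : Connection C) (e : Ω 1) (η : bimoduleCenter A (Ω 1))
    (z : Subalgebra.center ℂ A) :
    g.pi0 D (e <• (z : A)) η = g.pi0 D e ((η : Ω 1) <• (z : A)) := by
  have hz : ∀ a : A, a * z = z * a := Subalgebra.mem_center_iff.1 z.2
  have hs := T.centerMul_bijective.2
  have hd : ∀ b : A, (b : A) • C.dA z = C.dA z <• b := fun b => by
    have h := congrArg C.dA (hz b)
    rw [C.dA_mul, C.dA_mul, central_smul hs z hz, add_comm] at h
    exact add_right_cancel h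
  have h1 : g.contract (tmul A (tmul A e (C.dA z)) (η : Ω 1))
      = g.contract (tmul A (tmul A (η : Ω 1) (C.dA z)) e) := by
    induction e using center_induction hs with
    | h0 => simp
    | h2 x y hx hy => simp only [map_add, LinearMap.add_apply, hx, hy]
    | h1 ω b =>
      rw [contract_center, tmul_balanced, η.2 b, ← op_smul_tmul, map_smul, ← op_smul_tmul,
        contract_smul, contract_center, g.toHom_center_comm η ω]
      change (g.toHom _ * b) • C.dA z = _
      rw [mul_smul, hd, smul_comm]
  have h2 : tmul A (D.toHom (η : Ω 1)) (e <• (z : A))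
      = tmul A (D.toHom (η : Ω 1) <• (z : A)) e := by
    rw [tmul_balanced, central_smul hs z hz]
  have h3 : tmul A (D.toHom e <• (z : A)) (η : Ω 1)
      = tmul A (D.toHom e) ((η : Ω 1) <• (z : A)) := by
    rw [tmul_balanced, central_smul hs z hz]
  simp only [pi0, D.leibniz, map_add, LinearMap.add_apply, h1, h2, h3]
  abel

/-- For a fixed one-form `e`, the additive map determined by
`ηa ↦ (g ⊗ id) σ₂₃ (∇(ea) ⊗ η + ∇(η) ⊗ ea)` for central `η`. -/
def piAux (D : Connection C) (e : Ω 1) : Ω 1 →+ Ω 1 :=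
  (TensorProduct.liftAddHom
    { toFun := fun η : bimoduleCenter A (Ω 1) =>
        { toFun := fun a : A => g.pi0 D (e <• a) η
          map_zero' := by simp [pi0]
          map_add' := fun a b => by simp [pi0, add_smul]; abel }
      map_zero' := by ext; simp [pi0]
      map_add' := fun m n => by ext; simp [pi0]; abel }
    (by
      intro z η a
      have hz : ∀ a : A, a * z = z * a := Subalgebra.mem_center_iff.1 z.2
      change g.pi0 D (e <• a) ((z : A) • (η : Ω 1)) = g.pi0 D (e <• ((z : A) * a)) η
      rw [η.2 z, ← pi0_smul, ← hz a, op_mul, mul_smul])).comp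
  (AddEquiv.ofBijective (centerMul A (Ω 1)) T.centerMul_bijective).symm.toAddMonoidHom

theorem piAux_center (D : Connection C) (e : Ω 1) (η : bimoduleCenter A (Ω 1)) (a : A) :
    g.piAux D e ((η : Ω 1) <• a) = g.pi0 D (e <• a) η := by
  have h : (AddEquiv.ofBijective (centerMul A (Ω 1)) T.centerMul_bijective).symm
      ((η : Ω 1) <• a) = η ⊗ₜ a := by
    rw [AddEquiv.symm_apply_eq]
    rfl
  simp only [piAux, AddMonoidHom.comp_apply, AddEquiv.coe_toAddMonoidHom, h]
  rfl

/-- The map `Π_g(∇) : Ω 1 ⊗_A Ω 1 → Ω 1`. -/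
def PiMap (D : Connection C) : BalancedTensor A (Ω 1) (Ω 1) →ₗ[ℂ] Ω 1 :=
  lift A
    (LinearMap.mk₂ ℂ (fun e f => g.piAux D e f)
      (fun e e' f => by
        induction f using center_induction T.centerMul_bijective.2 with
        | h0 => simp
        | h1 η a => simp only [piAux_center]; simp [pi0]; abel
        | h2 x y hx hy => rw [map_add, hx, hy, map_add, map_add]; abel)
      (fun c e f => by
        induction f using center_induction T.centerMul_bijective.2 with
        | h0 => simp
        | h1 η a => simp only [piAux_center]; simp [pi0, smul_comm _ c]
        | h2 x y hx hy => rw [map_add, hx, hy, map_add, smul_add])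
      (fun e f f' => map_add _ f f')
      (fun c e f => by
        induction f using center_induction T.centerMul_bijective.2 with
        | h0 => simp
        | h1 η a =>
          rw [← smul_assoc, ← op_smul, piAux_center, piAux_center]
          simp [pi0]
        | h2 x y hx hy => rw [smul_add, map_add, hx, hy, map_add, smul_add]))
    (fun e a f => by
      simp only [LinearMap.mk₂_apply]
      induction f using center_induction T.centerMul_bijective.2 with
      | h0 => simp
      | h1 η b => rw [smul_comm, η.2 a, ← mul_smul, ← op_mul, piAux_center, piAux_center,
          op_mul, mul_smul]
      | h2 x y hx hy => rw [map_add, hx, hy, smul_add, map_add])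

/-- The formula that characterizes `Π_g(∇)`: for central `ω`, `η`,
`Π_g(∇)(ω ⊗ ηa) = (g ⊗ id) σ₂₃ (∇(ω) ⊗ η + ∇(η) ⊗ ω) a + g(ω ⊗ η) da`. -/
theorem PiMap_center (D : Connection C) (ω η : bimoduleCenter A (Ω 1)) (a : A) :
    g.PiMap D (tmul A (ω : Ω 1) ((η : Ω 1) <• a))
      = g.pi0 D ω η <• a + g.toHom (tmul A (ω : Ω 1) (η : Ω 1)) • C.dA a := by
  have h1 : tmul A (D.toHom (ω : Ω 1) <• a) (η : Ω 1) = tmul A (D.toHom (ω : Ω 1)) (η : Ω 1) <• a := by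
    rw [tmul_balanced, η.2 a, op_smul_tmul]
  have h : g.PiMap D (tmul A (ω : Ω 1) ((η : Ω 1) <• a)) = g.pi0 D ((ω : Ω 1) <• a) η :=
    (lift_tmul A _ _ _ _).trans (g.piAux_center D ω η a)
  rw [h, pi0, pi0, D.leibniz, map_add, map_add, LinearMap.add_apply, h1, ← op_smul_tmul, map_add,
    map_add, contract_smul, contract_smul, contract_center, smul_add]
  abel

/-- `∇` is compatible with `g` if `Π_g(∇)(e ⊗ f) = d(g(e ⊗ f))`. -/
def IsCompatible (D : Connection C) : Prop :=
  ∀ e f : Ω 1, g.PiMap D (tmul A e f) = C.dA (g.toHom (tmul A e f))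

/-- A Levi-Civita connection for `g`: torsionless and compatible with `g`. -/
def IsLeviCivita (D : Connection C) : Prop := D.IsTorsionless ∧ g.IsCompatible D

end PseudoRiemannianMetric

end Tame

end NCGeometry

end

/-! Central one-forms carry the proof. They generate the one-forms as a right module, σ is the flip
on them, and a bilinear metric has central values on them, so the classical computations go through
there although `A` is noncommutative. Connections and the compatibility condition are determined by
central arguments (`Connection.ext_center`, `isCompatible_iff_center`).

Write g for the bilinear metric. For central η, `contract` pairs the first leg of a tensor with η,
while `zeta` after `id ⊗ V_g` pairs the second leg; σ exchanges the two (`contract_eq_zeta`). Since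
ζ and `V_g` are invertible, these contractions determine the tensor (`eq_of_contract`). By
definition the metric element acts as the identity through its second leg; the symmetry of g gives
the same for the first leg, so the element is fixed by σ, which means that it lies in Ker ∧.

Since k g need not be bilinear, all contractions are made with g, and k only enters as a left factor
of the compatibility condition. For uniqueness, the difference of two Levi-Civita connections is
symmetric by torsion-freeness and antisymmetric by compatibility; a trilinear expression symmetric
in one adjacent pair of arguments and antisymmetric in the other vanishes
(`eq_zero_of_symmetric_of_antisymmetric`). For existence, the correction takes values in Ker ∧, so
torsion is unchanged. Symmetrizing its contraction over ω and η cancels all terms except k⁻¹ dk g(ω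
⊗ η), exactly what the Leibniz rule for d(k g) requires (`contract_conformalCorrection`). -/

noncomputable section

namespace NCGeometry

variable {A : Type*} [Ring A] [Algebra ℂ A] {Ω : ℕ → Type*}
  [∀ n, AddCommGroup (Ω n)] [∀ n, Module ℂ (Ω n)] [∀ n, Module A (Ω n)]
  [∀ n, Module Aᵐᵒᵖ (Ω n)] [∀ n, SMulCommClass A Aᵐᵒᵖ (Ω n)]
  [∀ n, IsScalarTower ℂ A (Ω n)] [∀ n, IsScalarTower ℂ Aᵐᵒᵖ (Ω n)]
  {C : DifferentialCalculus A Ω} {T : Tame C}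

/-- The product `∧` on one-forms is left `A`-linear. -/
theorem DifferentialAlgebra.wedgeOne_smul (C : DifferentialAlgebra A Ω) (a : A)
    (X : BalancedTensor A (Ω 1) (Ω 1)) : C.wedgeOne (a • X) = a • C.wedgeOne X := by
  induction X using tensor_induction with
  | h0 => simp
  | h1 e f => rw [smul_tmul]; exact C.wedge_smul_left rfl a e f
  | h2 x y hx hy => simp only [smul_add, map_add, hx, hy]

/-! ### Symmetrization and the flip σ -/

namespace Tame

variable (T)

theorem sigma_sigma (X : BalancedTensor A (Ω 1) (Ω 1)) : T.sigma (T.sigma X) = X := by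
  induction X using tensor_center_induction T.centerMul_bijective.2 with
  | h0 => simp
  | h1 m n a => rw [sigma_center_smul, sigma_center_smul]
  | h2 x y hx hy => simp only [map_add, hx, hy]

theorem sigma_apply (X : BalancedTensor A (Ω 1) (Ω 1)) : T.sigma X = 2 • T.Psym X - X := rfl

theorem wedgeOne_Psym (X : BalancedTensor A (Ω 1) (Ω 1)) : C.wedgeOne (T.Psym X) = 0 :=
  LinearMap.mem_ker.1 (Submodule.projection_apply_mem T.isCompl X)

theorem Psym_eq (X : BalancedTensor A (Ω 1) (Ω 1)) :
    T.Psym X = (1 / 2 : ℂ) • (X + T.sigma X) := by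
  rw [sigma_apply, add_sub_cancel, ← Nat.cast_smul_eq_nsmul ℂ, smul_smul]
  norm_num

/-- The symmetric tensors are the kernel of `∧`. -/
theorem sigma_eq_self_iff {X : BalancedTensor A (Ω 1) (Ω 1)} :
    T.sigma X = X ↔ C.wedgeOne X = 0 := by
  constructor
  · intro h
    have h1 := T.Psym_eq X
    rw [h, ← two_smul ℂ, smul_smul] at h1
    norm_num at h1
    rw [← h1, wedgeOne_Psym]
  · intro h
    have h1 : T.Psym X = X :=
      Submodule.projection_apply_of_mem_left T.isCompl (LinearMap.mem_ker.2 h)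
    rw [sigma_apply, h1, two_smul, add_sub_cancel_right]

/-- One central leg suffices for σ to be the flip: the coefficient of the other leg crosses the
tensor sign and commutes with η. -/
theorem sigma_tmul_center (e : Ω 1) (η : bimoduleCenter A (Ω 1)) :
    T.sigma (tmul A e (η : Ω 1)) = tmul A (η : Ω 1) e := by
  induction e using center_induction T.centerMul_bijective.2 with
  | h0 => simp
  | h1 m a => rw [tmul_balanced, η.2 a, sigma_center_smul]
  | h2 x y hx hy => simp only [map_add, LinearMap.add_apply, hx, hy]

end Tame

/-! ### Connections as an affine space, determined on central forms -/

namespace Connection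

@[ext]
theorem ext {D D' : Connection C} (h : D.toHom = D'.toHom) : D = D' := by
  cases D; cases D'; cases h; rfl

/-- A connection on a tame calculus is determined by its values on central one-forms. -/
theorem ext_center (T : Tame C) {D D' : Connection C}
    (h : ∀ ω : bimoduleCenter A (Ω 1), D.toHom (ω : Ω 1) = D'.toHom (ω : Ω 1)) : D = D' := by
  refine Connection.ext (LinearMap.ext fun e => ?_)
  induction e using center_induction T.centerMul_bijective.2 with
  | h0 => simp
  | h1 m a => rw [D.leibniz, D'.leibniz, h]
  | h2 x y hx hy => simp only [map_add, hx, hy]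

/-- The sum of a connection and a right `A`-linear map. -/
def addHom (D : Connection C) (L : Ω 1 →ₗ[Aᵐᵒᵖ] BalancedTensor A (Ω 1) (Ω 1)) :
    Connection C where
  toHom := D.toHom + L.restrictScalars ℂ
  leibniz e a := by
    simp only [LinearMap.add_apply, LinearMap.restrictScalars_apply, D.leibniz, map_smul,
      smul_add]
    abel

theorem addHom_apply (D : Connection C) (L : Ω 1 →ₗ[Aᵐᵒᵖ] BalancedTensor A (Ω 1) (Ω 1))
    (e : Ω 1) : (D.addHom L).toHom e = D.toHom e + L e := rfl

end Connection

/-! ### Compatibility on central forms and the effect of a conformal factor -/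

namespace PseudoRiemannianMetric

variable (g : PseudoRiemannianMetric T)

/-- Compatibility with a metric need only be checked on central one-forms. -/
theorem isCompatible_iff_center (D : Connection C) :
    g.IsCompatible D ↔ ∀ ω η : bimoduleCenter A (Ω 1),
      g.pi0 D (ω : Ω 1) (η : Ω 1) = C.dA (g.toHom (tmul A (ω : Ω 1) (η : Ω 1))) := by
  have key (ω η : bimoduleCenter A (Ω 1)) (a : A) :
      C.dA (g.toHom (tmul A (ω : Ω 1) ((η : Ω 1) <• a)))
        = C.dA (g.toHom (tmul A (ω : Ω 1) (η : Ω 1))) <• a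
          + g.toHom (tmul A (ω : Ω 1) (η : Ω 1)) • C.dA a := by
    rw [← op_smul_tmul, map_smul]
    exact C.dA_mul _ a
  constructor
  · intro h ω η
    -- Taking a = 1 brings η to the shape that `PiMap_center` expects; the term with `C.dA 1`
    -- appears on both sides and cancels.
    have h1 := h (ω : Ω 1) ((η : Ω 1) <• (1 : A))
    rw [PiMap_center, key, add_right_cancel_iff] at h1
    simpa using h1
  · intro h e f
    induction tmul A e f using tensor_center_induction T.centerMul_bijective.2 with
    | h0 => simp
    | h1 ω η a => rw [PiMap_center, key, h]
    | h2 x y hx hy => simp only [map_add, hx, hy]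

/-- σ₂₃ does not involve the metric, and k stands to the left of the value of g, so it factors out
without any bilinearity or centrality. -/
theorem conformal_contract (k : Aˣ)
    (x : BalancedTensor A (BalancedTensor A (Ω 1) (Ω 1)) (Ω 1)) :
    (g.conformal k).contract x = (k : A) • g.contract x := by
  simp only [contract, LinearMap.comp_apply]
  induction T.sigma23 x using tensor_induction with
  | h0 => simp
  | h1 X e => rw [tensorId_tmul, tensorId_tmul]; exact mul_smul _ _ _
  | h2 x y hx hy => simp only [map_add, hx, hy, smul_add]

theorem conformal_pi0 (k : Aˣ) (D : Connection C) (e f : Ω 1) :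
    (g.conformal k).pi0 D e f = (k : A) • g.pi0 D e f :=
  g.conformal_contract k _

/-! ### Contraction of two-tensors with central one-forms -/

theorem contract_leftSmul (hg : g.IsBilinear) (a : A) (X : BalancedTensor A (Ω 1) (Ω 1))
    (η : bimoduleCenter A (Ω 1)) :
    g.contract (tmul A (a • X) (η : Ω 1)) = a • g.contract (tmul A X (η : Ω 1)) := by
  induction X using tensor_induction with
  | h0 => simp
  | h1 e f => rw [smul_tmul, contract_center, contract_center, ← smul_tmul, hg, mul_smul]
  | h2 x y hx hy => simp only [smul_add, map_add, LinearMap.add_apply, hx, hy]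

/-- The scalar moves to η, commutes with it, and leaves on the far right, where `contract` is right
linear. -/
theorem contract_rightSmul (X : BalancedTensor A (Ω 1) (Ω 1)) (a : A)
    (η : bimoduleCenter A (Ω 1)) :
    g.contract (tmul A (X <• a) (η : Ω 1)) = g.contract (tmul A X (η : Ω 1)) <• a := by
  rw [tmul_balanced, η.2 a, ← op_smul_tmul, contract_smul]

/-- A bilinear metric takes central values on central one-forms. -/
theorem toHom_center_commute (hg : g.IsBilinear) (ω η : bimoduleCenter A (Ω 1)) (a : A) :
    a * g.toHom (tmul A (ω : Ω 1) (η : Ω 1)) = g.toHom (tmul A (ω : Ω 1) (η : Ω 1)) * a := by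
  rw [← hg, smul_tmul, ω.2 a, tmul_balanced, η.2 a, ← op_smul_tmul, map_smul]
  rfl

/-- Nondegeneracy can be tested on central forms because they generate the one-forms as a right
module and g is right linear. -/
theorem eq_of_toHom_center {e f : Ω 1}
    (h : ∀ θ : bimoduleCenter A (Ω 1),
      g.toHom (tmul A e (θ : Ω 1)) = g.toHom (tmul A f (θ : Ω 1))) : e = f := by
  refine g.nondegenerate.1 (LinearMap.ext fun x => ?_)
  change g.toHom (tmul A e x) = g.toHom (tmul A f x)
  induction x using center_induction T.centerMul_bijective.2 with
  | h0 => simp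
  | h1 m a => rw [← op_smul_tmul, ← op_smul_tmul, map_smul, map_smul, h]
  | h2 x y hx hy => simp only [map_add, hx, hy]

/-- Contraction of the first leg of `X` with a central one-form is contraction of the second leg
of `σ(X)`. -/
theorem contract_eq_zeta (hg : g.IsBilinear) (X : BalancedTensor A (Ω 1) (Ω 1))
    (η : bimoduleCenter A (Ω 1)) :
    g.contract (tmul A X (η : Ω 1)) =
      zeta A (idTensor A (Ω 1) (g.metricEquiv hg).toLinearMap (T.sigma X)) (η : Ω 1) := by
  induction X using tensor_center_induction T.centerMul_bijective.2 with
  | h0 => simp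
  | h1 u v a =>
    rw [contract_center, T.sigma_center_smul, idTensor_tmul, zeta_tmul]
    change _ = (v : Ω 1) <• g.toHom (tmul A ((u : Ω 1) <• a) (η : Ω 1))
    rw [tmul_balanced, η.2 a, ← op_smul_tmul, map_smul, smul_comm, v.2, ← mul_smul, ← op_mul]
    rfl
  | h2 x y hx hy => simp only [map_add, LinearMap.add_apply, hx, hy]

/-- For X = u ⊗ va with u, v central, both sides are products of g(u ⊗ θ), g(v ⊗ η) and a, up to
order; centrality of these values of g makes them agree. For a symmetric X this says that pairing
both legs with η and θ is symmetric in η and θ. -/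
theorem toHom_contract_sigma (hg : g.IsBilinear) (X : BalancedTensor A (Ω 1) (Ω 1))
    (η θ : bimoduleCenter A (Ω 1)) :
    g.toHom (tmul A (g.contract (tmul A (T.sigma X) (η : Ω 1))) (θ : Ω 1)) =
      g.toHom (tmul A (g.contract (tmul A X (θ : Ω 1))) (η : Ω 1)) := by
  have key (u v η θ : bimoduleCenter A (Ω 1)) (a : A) :
      g.toHom (tmul A (g.contract (tmul A (tmul A (u : Ω 1) ((v : Ω 1) <• a)) (η : Ω 1)))
        (θ : Ω 1)) = g.toHom (tmul A (u : Ω 1) (η : Ω 1)) *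
          (g.toHom (tmul A (v : Ω 1) (θ : Ω 1)) * a) := by
    rw [contract_center, ← smul_tmul, hg, tmul_balanced, θ.2 a, ← op_smul_tmul, map_smul]
    rfl
  induction X using tensor_center_induction T.centerMul_bijective.2 with
  | h0 => simp
  | h1 u v a =>
    rw [T.sigma_center_smul, key, key, ← mul_assoc, ← mul_assoc, g.toHom_center_commute hg v η]
  | h2 x y hx hy => simp only [map_add, LinearMap.add_apply, hx, hy]

/-- A tensor is determined by its contractions with central one-forms. -/
theorem eq_of_contract (hg : g.IsBilinear) {X Y : BalancedTensor A (Ω 1) (Ω 1)}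
    (h : ∀ η : bimoduleCenter A (Ω 1),
      g.contract (tmul A X (η : Ω 1)) = g.contract (tmul A Y (η : Ω 1))) : X = Y := by
  have hfin := T.finite
  have hproj := T.projective
  -- `contract` sees first legs and `zeta` second legs, hence σ(X) and σ(Y). Right linearity extends
  -- the equality from central forms to all forms, and injectivity of ζ and of id ⊗ V_g then
  -- applies.
  have h1 : zeta A (idTensor A (Ω 1) (g.metricEquiv hg).toLinearMap (T.sigma X))
      = zeta A (idTensor A (Ω 1) (g.metricEquiv hg).toLinearMap (T.sigma Y)) := by
    refine LinearMap.ext fun x => ?_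
    induction x using center_induction T.centerMul_bijective.2 with
    | h0 => simp
    | h1 m a => rw [map_smul, map_smul, ← contract_eq_zeta, ← contract_eq_zeta, h]
    | h2 x y hx hy => simp only [map_add, hx, hy]
  have h2 : ∀ Z : BalancedTensor A (Ω 1) (Ω 1),
      idTensor A (Ω 1) (g.metricEquiv hg).symm.toLinearMap
        (idTensor A (Ω 1) (g.metricEquiv hg).toLinearMap Z) = Z := fun Z => by
    induction Z using tensor_induction with
    | h0 => simp
    | h1 m n => simp
    | h2 x y hx hy => simp only [map_add, hx, hy]
  have h3 := congrArg (idTensor A (Ω 1) (g.metricEquiv hg).symm.toLinearMap)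
    ((zeta_bijective A).1 h1)
  rw [h2, h2] at h3
  rw [← T.sigma_sigma X, h3, T.sigma_sigma]

/-! ### The metric element and its symmetry -/

theorem zeta_metricElement (hg : g.IsBilinear) :
    zeta A (idTensor A (Ω 1) (g.metricEquiv hg).toLinearMap (g.metricElement hg))
      = LinearMap.id := by
  have hfin := T.finite
  have hproj := T.projective
  have h2 : ∀ Z : BalancedTensor A (Ω 1) (RightDual A (Ω 1)),
      idTensor A (Ω 1) (g.metricEquiv hg).toLinearMap
        (idTensor A (Ω 1) (g.metricEquiv hg).symm.toLinearMap Z) = Z := fun Z => by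
    induction Z using tensor_induction with
    | h0 => simp
    | h1 m n => simp
    | h2 x y hx hy => simp only [map_add, hx, hy]
  rw [metricElement, h2]
  exact (LinearEquiv.ofBijective (zeta A (M := Ω 1) (N := Ω 1))
    (zeta_bijective A)).apply_symm_apply LinearMap.id

/-- Pairing the result with θ and exchanging the roles of η and θ turns the first-leg contraction
into the second-leg one, which is the identity by construction. What remains is g(θ ⊗ η) = g(η ⊗ θ).
-/
theorem contract_metricElement (hg : g.IsBilinear) (η : bimoduleCenter A (Ω 1)) :
    g.contract (tmul A (g.metricElement hg) (η : Ω 1)) = η := by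
  refine g.eq_of_toHom_center fun θ => ?_
  rw [← toHom_contract_sigma g hg, contract_eq_zeta g hg, T.sigma_sigma, zeta_metricElement,
    LinearMap.id_apply, toHom_center_comm]

/-- The contractions of the element through its first and its second leg are both the identity on
central forms, so σ does not change its contractions, and these determine a tensor. -/
theorem sigma_metricElement (hg : g.IsBilinear) :
    T.sigma (g.metricElement hg) = g.metricElement hg := by
  refine g.eq_of_contract hg fun η => ?_
  rw [contract_metricElement, contract_eq_zeta g hg, T.sigma_sigma, zeta_metricElement,
    LinearMap.id_apply]

/-! ### Uniqueness of the Levi-Civita connection -/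

/-- A family of symmetric tensors `M(ω)` for which `(ω, η) ↦ (g ⊗ id) σ₂₃ (M(ω) ⊗ η)` is
antisymmetric on central one-forms vanishes. -/
theorem eq_zero_of_symmetric_of_antisymmetric (hg : g.IsBilinear)
    (M : bimoduleCenter A (Ω 1) → BalancedTensor A (Ω 1) (Ω 1))
    (hs : ∀ ω, T.sigma (M ω) = M ω)
    (ha : ∀ ω η : bimoduleCenter A (Ω 1), g.contract (tmul A (M ω) (η : Ω 1))
      + g.contract (tmul A (M η) (ω : Ω 1)) = 0) (ω : bimoduleCenter A (Ω 1)) : M ω = 0 := by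
  set t : bimoduleCenter A (Ω 1) → bimoduleCenter A (Ω 1) → bimoduleCenter A (Ω 1) → A :=
    fun ω η θ => g.toHom (tmul A (g.contract (tmul A (M ω) (η : Ω 1))) (θ : Ω 1)) with ht
  have h1 : ∀ ω η θ, t ω η θ = t ω θ η := fun ω η θ => by
    have h := g.toHom_contract_sigma hg (M ω) η θ
    rwa [hs] at h
  have h2 : ∀ ω η θ, t ω η θ = -t η ω θ := fun ω η θ => by
    simp only [ht]
    rw [eq_neg_of_add_eq_zero_left (ha ω η)]
    simp
  refine g.eq_of_contract hg fun η => g.eq_of_toHom_center fun θ => ?_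
  -- `t` changes sign when its first two arguments are swapped and is invariant under swapping the
  -- last two. Going once around the six orderings of the arguments uses three swaps of each kind,
  -- hence an odd number of signs.
  have h3 : t ω η θ = -t ω η θ := by
    calc t ω η θ = -t η ω θ := h2 _ _ _
      _ = -t η θ ω := by rw [h1]
      _ = t θ η ω := by rw [h2 θ]
      _ = t θ ω η := h1 _ _ _
      _ = -t ω θ η := h2 _ _ _
      _ = -t ω η θ := by rw [h1]
  have h4 : (2 : ℂ) • t ω η θ = 0 := by
    rw [two_smul]
    nth_rw 1 [h3]
    exact neg_add_cancel _
  have h5 : t ω η θ = 0 := (smul_eq_zero_iff_right (two_ne_zero)).1 h4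
  simpa [ht] using h5

/-- A conformal deformation of a bilinear metric has at most one Levi-Civita connection. -/
theorem IsLeviCivita.unique_conformal (hg : g.IsBilinear) {k : Aˣ} {D D' : Connection C}
    (h : (g.conformal k).IsLeviCivita D) (h' : (g.conformal k).IsLeviCivita D') : D = D' := by
  refine Connection.ext_center T fun ω => sub_eq_zero.1 ?_
  refine g.eq_zero_of_symmetric_of_antisymmetric hg
    (fun ω => D.toHom (ω : Ω 1) - D'.toHom (ω : Ω 1)) (fun ω => ?_) (fun ω η => ?_) ω
  -- Both connections have ∧ ∘ ∇ = -d, so their difference lies in Ker ∧.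
  · rw [T.sigma_eq_self_iff, map_sub, eq_neg_of_add_eq_zero_left (h.1 ω),
      eq_neg_of_add_eq_zero_left (h'.1 ω), sub_self]
  · have h1 := ((g.conformal k).isCompatible_iff_center D).1 h.2 ω η
    rw [← ((g.conformal k).isCompatible_iff_center D').1 h'.2 ω η, conformal_pi0,
      conformal_pi0] at h1
    -- Cancelling k leaves an equation in the bilinear metric g alone, to which the preceding lemma
    -- applies.
    have h2 := congrArg (fun x => (↑k⁻¹ : A) • x) h1
    simp only [← mul_smul, Units.inv_mul, one_smul, pi0, map_add] at h2
    simp only [map_sub, LinearMap.sub_apply]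
    rw [sub_add_sub_comm, h2, sub_self]

/-! ### The conformal correction and existence -/

/-- The right `A`-linear map `ω ↦ k⁻¹ P_sym(dk ⊗ ω) - ½ k⁻¹ Ω_g g(dk ⊗ ω)`. -/
def conformalCorrection (hg : g.IsBilinear) (k : Aˣ) :
    Ω 1 →ₗ[Aᵐᵒᵖ] BalancedTensor A (Ω 1) (Ω 1) where
  toFun ω := (↑k⁻¹ : A) • T.Psym (tmul A (C.dA k) ω)
    - (1 / 2 : ℂ) • (↑k⁻¹ : A) • (g.metricElement hg <• g.toHom (tmul A (C.dA k) ω))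
  map_add' ω η := by
    simp only [map_add, smul_add, op_add, add_smul]
    abel
  map_smul' a ω := by
    rw [← op_smul_tmul, map_smul, map_smul, RingHom.id_apply, smul_sub,
      smul_comm _ a, show op (a • g.toHom (tmul A (C.dA k) ω))
        = a * op (g.toHom (tmul A (C.dA k) ω)) from rfl, mul_smul, smul_comm _ a,
      smul_comm (1 / 2 : ℂ) a]

theorem conformalCorrection_apply (hg : g.IsBilinear) (k : Aˣ) (ω : Ω 1) :
    g.conformalCorrection hg k ω = (↑k⁻¹ : A) • T.Psym (tmul A (C.dA k) ω)
      - (1 / 2 : ℂ) • (↑k⁻¹ : A) • (g.metricElement hg <• g.toHom (tmul A (C.dA k) ω)) := rfl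

/-- Both terms come from symmetric tensors, and Ker ∧ is stable under both actions of `A`. -/
theorem wedgeOne_conformalCorrection (hg : g.IsBilinear) (k : Aˣ) (ω : Ω 1) :
    C.wedgeOne (g.conformalCorrection hg k ω) = 0 := by
  rw [conformalCorrection_apply, map_sub, C.wedgeOne_smul, LinearMap.map_smul_of_tower C.wedgeOne (1 / 2 : ℂ),
    C.wedgeOne_smul, map_smul, T.wedgeOne_Psym,
    T.sigma_eq_self_iff.1 (g.sigma_metricElement hg)]
  simp

/-- P_sym(dk ⊗ ω) is half of dk ⊗ ω + ω ⊗ dk, which accounts for the first two terms, and the metric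
element contracts to η. The coefficient ½ in front of that element makes the first and third terms
cancel once ω and η are interchanged and the results added. -/
theorem contract_conformalCorrection (hg : g.IsBilinear) (k : Aˣ)
    (ω η : bimoduleCenter A (Ω 1)) :
    g.contract (tmul A (g.conformalCorrection hg k ω) (η : Ω 1)) = (↑k⁻¹ : A) • (1 / 2 : ℂ) •
      (g.toHom (tmul A (C.dA k) (η : Ω 1)) • (ω : Ω 1)
        + C.dA k <• g.toHom (tmul A (ω : Ω 1) (η : Ω 1))
        - g.toHom (tmul A (C.dA k) (ω : Ω 1)) • (η : Ω 1)) := by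
  rw [conformalCorrection_apply, smul_comm (1 / 2 : ℂ), ← smul_sub, T.Psym_eq, ← smul_sub,
    T.sigma_tmul_center, contract_leftSmul g hg, map_smul, LinearMap.smul_apply, map_smul,
    map_sub, map_add, LinearMap.sub_apply, LinearMap.add_apply, map_sub, map_add,
    contract_center, contract_center, contract_rightSmul, contract_metricElement, ← η.2,
    central_smul T.centerMul_bijective.2 _ (fun a => g.toHom_center_commute hg ω η a)]

/-- The explicit Levi-Civita connection of a conformal deformation of a bilinear metric. -/
theorem IsLeviCivita.conformal (hg : g.IsBilinear) (k : Aˣ) {D : Connection C}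
    (h : g.IsLeviCivita D) :
    (g.conformal k).IsLeviCivita (D.addHom (g.conformalCorrection hg k)) := by
  refine ⟨fun e => ?_, ((g.conformal k).isCompatible_iff_center _).2 fun ω η => ?_⟩
  · rw [Connection.addHom_apply, map_add, wedgeOne_conformalCorrection, add_zero, h.1 e]
  · have h1 := (g.isCompatible_iff_center D).1 h.2 ω η
    have h2 : g.pi0 (D.addHom (g.conformalCorrection hg k)) (ω : Ω 1) (η : Ω 1)
        = g.pi0 D ω η + (g.contract (tmul A (g.conformalCorrection hg k ω) (η : Ω 1))
          + g.contract (tmul A (g.conformalCorrection hg k η) (ω : Ω 1))) := by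
      simp only [pi0, Connection.addHom_apply, map_add, LinearMap.add_apply]
      abel
    have h3 : g.contract (tmul A (g.conformalCorrection hg k ω) (η : Ω 1))
          + g.contract (tmul A (g.conformalCorrection hg k η) (ω : Ω 1))
        = (↑k⁻¹ : A) • (C.dA k <• g.toHom (tmul A (ω : Ω 1) (η : Ω 1))) := by
      rw [contract_conformalCorrection, contract_conformalCorrection,
        g.toHom_center_comm η ω, ← smul_add, ← smul_add]
      congr 1
      generalize C.dA k <• g.toHom (tmul A (ω : Ω 1) (η : Ω 1)) = x
      generalize g.toHom (tmul A (C.dA k) (η : Ω 1)) • (ω : Ω 1) = y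
      generalize g.toHom (tmul A (C.dA k) (ω : Ω 1)) • (η : Ω 1) = z
      module
    -- Multiplying by k cancels the k⁻¹ of the correction and leaves dk g(ω ⊗ η) + k d(g(ω ⊗ η)),
    -- the Leibniz expansion of d(k g(ω ⊗ η)).
    rw [conformal_pi0, h2, h3, h1, smul_add, ← mul_smul, Units.mul_inv, one_smul, add_comm]
    exact (C.dA_mul _ _).symm

end PseudoRiemannianMetric

end NCGeometry

end

theorem theorem5p4 {A : Type*} [Ring A] [Algebra ℂ A] {Ω : ℕ → Type*}
    [∀ n, AddCommGroup (Ω n)] [∀ n, Module ℂ (Ω n)] [∀ n, Module A (Ω n)]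
    [∀ n, Module Aᵐᵒᵖ (Ω n)] [∀ n, SMulCommClass A Aᵐᵒᵖ (Ω n)]
    [∀ n, IsScalarTower ℂ A (Ω n)] [∀ n, IsScalarTower ℂ Aᵐᵒᵖ (Ω n)]
    (C : NCGeometry.DifferentialCalculus A Ω) (T : NCGeometry.Tame C)
    (g₀ : NCGeometry.PseudoRiemannianMetric T) (hg₀ : g₀.IsBilinear) :
    -- the metric element is symmetric
    g₀.metricElement hg₀ ∈ LinearMap.ker C.wedgeOne ∧
    -- the Levi-Civita connection of `k g₀` exists, is unique, and is given by the formula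
    ∀ D₀ : NCGeometry.Connection C, g₀.IsLeviCivita D₀ → ∀ k : Aˣ,
      ∃ D : NCGeometry.Connection C, (g₀.conformal k).IsLeviCivita D ∧
        (∀ D' : NCGeometry.Connection C, (g₀.conformal k).IsLeviCivita D' → D' = D) ∧
        ∀ ω : Ω 1, D.toHom ω = D₀.toHom ω
          + (↑k⁻¹ : A) • T.Psym (NCGeometry.tmul A (C.dA k) ω)
          - (1 / 2 : ℂ) • (↑k⁻¹ : A) •
              (g₀.metricElement hg₀ <• g₀.toHom (NCGeometry.tmul A (C.dA k) ω)) := by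
  refine ⟨T.sigma_eq_self_iff.1 (g₀.sigma_metricElement hg₀), fun D₀ h k => ?_⟩
  have hD := NCGeometry.PseudoRiemannianMetric.IsLeviCivita.conformal g₀ hg₀ k h
  -- The witness is read off from `hD`: it is `D₀` plus the conformal correction.
  refine ⟨_, hD, fun D' h' => h'.unique_conformal g₀ hg₀ hD, fun ω => ?_⟩
  rw [NCGeometry.Connection.addHom_apply, g₀.conformalCorrection_apply, add_sub_assoc]
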